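/- Let $G\subset GL(2,\mathbf C)$ be a finite subgroup without pseudo-reflections (no $g\in G$ with $\operatorname{rank}(g-1)=1$), acting on $A=\mathbf C[x,y]$ by $(ga)(v)=a(g^{-1}v)$, and let $A^G$ be the ring of invariants. Let $\rho:G\to GL(V)$ be a finite-dimensional complex representation and let $W_\rho=(V\otimes_{\mathbf C}A)^G$ be the $A^G$-module of invariants for $g(v\otimes a)=\rho(g)v\otimes ga$. Let $\operatorname{Der}_{\mathbf C}(A)^G$ be the derivations $\delta$ of $A$ with $g\circ\delta\circ g^{-1}=\delta$ for all $g\in G$. For an algebra $B$ over a field $F$ and a $B$-module $W$, let $\mathbf V_W\subset\operatorname{Der}_F(B)$ be the kernel of the Kodaira–Spencer map $\operatorname{Der}_F(B)\to\operatorname{Ext}^1_B(W,W)=\operatorname{HH}^1(B,\operatorname{End}_F(W))$, $\delta\mapsto[\,a\mapsto(w\mapsto\delta(a)w)\,]$. For a Lie–Rinehart subalgebra $\mathfrak g\subset\operatorname{Der}_F(B)$, a $\mathfrak g$-connection on $W$ is a $B$-linear map $\nabla:\mathfrak g\to\operatorname{End}_F(W)$ with $\nabla_\delta(bw)=b\nabla_\delta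 w+\delta(b)w$; it is flat if it is a homomorphism of Lie algebras, and its curvature is $R_\nabla(\delta,\eta)=[\nabla_\delta,\nabla_\eta]-\nabla_{[\delta,\eta]}$. Let $U\subset\operatorname{Spec}B$ be the open set where $W$ is locally free of finite rank. Given a $\mathbf V_W$-connection $\nabla$, the first Chern class $c_1(W)$ is the class of $\operatorname{trace}\circ R_\nabla$ in the second cohomology $\mathrm H^2(\mathbf V_W|_U,\mathcal O_U)$ of the Chevalley–Hochschild complex $\operatorname{Hom}_{\mathcal O_U}(\wedge^\bullet\mathbf V_W|_U,\mathcal O_U)$. Then the following hold. 1. For $\delta\in\operatorname{Der}_{\mathbf C}(A)^G$ the operator $1\otimes\delta$ on $V\otimes_{\mathbf C}A$ maps $W_\rho$ to itself. 2. Every $\delta\in\operatorname{Der}_{\mathbf C}(A)^G$ maps $A^G$ to itself, and restriction to $A^G$ is an isomorphism $\operatorname{Der}_{\mathbf C}(A)^G\cong\operatorname{Der}_{\mathbf C}(A^G)$ of $A^G$-modules and of Lie algebras. 3. Through this isomorphism the operators $1\otimes\delta$ define a flat $\operatorname{Der}_{\mathbf C}(A^G)$-connection on $W_\rho$; in particular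 $\mathbf V_{W_\rho}=\operatorname{Der}_{\mathbf C}(A^G)$. 4. $c_1(W_\rho)=0$: the module $W_\rho$ has a $\mathbf V_{W_\rho}$-connection, and for every $\mathbf V_{W_\rho}$-connection $\nabla$ on $W_\rho$ the cochain $\operatorname{trace}\circ R_\nabla$ is a cocycle whose class in $\mathrm H^2(\mathbf V_{W_\rho}|_U,\mathcal O_U)$ is zero. -/

import Mathlib

open scoped TensorProduct
open TopologicalSpace AlgebraicGeometry

noncomputable section

namespace LRChern

section Connections

variable {F A L W : Type*} [CommRing F] [CommRing A] [Algebra F A]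
  [LieRing L] [Module A L] [LieRingModule L A]
  [AddCommGroup W] [Module F W] [Module A W] [IsScalarTower F A W]

variable (F A L W) in
/-- An `L`-connection on the `A`-module `W`, for a Lie-Rinehart algebra `L` over `A / F`: an
`A`-linear map `∇ : L → End_F W` with `∇_x (a w) = a ∇_x w + x(a) w`, where `x(a) = ⁅x, a⁆` is the
action of `L` on `A` through its anchor. -/
structure Connection where
  /-- the covariant derivation -/
  toLin : L →ₗ[A] Module.End F W
  leibniz : ∀ (x : L) (a : A) (w : W), toLin x (a • w) = a • toLin x w + ⁅x, a⁆ • w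

/-- A connection is flat if it is a homomorphism of Lie algebras. -/
def Connection.IsFlat (D : Connection F A L W) : Prop :=
  ∀ (x y : L) (w : W), D.toLin ⁅x, y⁆ w = D.toLin x (D.toLin y w) - D.toLin y (D.toLin x w)

/-- The curvature `R(x, y) = [∇_x, ∇_y] - ∇_[x, y]`, an `A`-linear endomorphism of `W`. -/
def Connection.curvature (D : Connection F A L W) (x y : L) : Module.End A W where
  toFun w := D.toLin x (D.toLin y w) - D.toLin y (D.toLin x w) - D.toLin ⁅x, y⁆ w
  map_add' v w := by simp only [map_add]; abel
  map_smul' a w := by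
    simp only [D.leibniz, map_add, lie_lie, sub_smul, smul_sub, RingHom.id_apply]
    abel

@[simp] lemma Connection.curvature_apply (D : Connection F A L W) (x y : L) (w : W) :
    D.curvature x y w =
      D.toLin x (D.toLin y w) - D.toLin y (D.toLin x w) - D.toLin ⁅x, y⁆ w := rfl

/-- The curvature as an `A`-bilinear map. -/
def Connection.curvatureForm [LieRinehartRing A L] (D : Connection F A L W) :
    L →ₗ[A] L →ₗ[A] Module.End A W :=
  LinearMap.mk₂ A D.curvature
    (fun x y z => by
      ext w
      simp only [Connection.curvature_apply, LinearMap.add_apply, map_add, add_lie]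
      abel)
    (fun a x y => by
      ext w
      have h : ⁅a • x, y⁆ = a • ⁅x, y⁆ - ⁅y, a⁆ • x := by
        rw [← lie_skew, LieRinehartRing.leibniz_smul_right, ← lie_skew x y, smul_neg]
        abel
      simp only [Connection.curvature_apply, LinearMap.smul_apply, map_smul, h, map_sub,
        LinearMap.sub_apply, D.leibniz, smul_sub]
      abel)
    (fun x y z => by
      ext w
      simp only [Connection.curvature_apply, LinearMap.add_apply, map_add, lie_add]
      abel)
    (fun a x y => by
      ext w
      simp only [Connection.curvature_apply, LinearMap.smul_apply, map_smul,
        LieRinehartRing.leibniz_smul_right, map_add, LinearMap.add_apply, D.leibniz, smul_sub]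
      abel)

variable (F A) in
/-- The trivial connection `d ↦ d ⊗ 1` on the `A`-module `V ⊗ A`, written `A ⊗ V`. -/
def trivialConnection (V : Type*) [AddCommGroup V] [Module F V] :
    Connection F A (Derivation F A A) (A ⊗[F] V) where
  toLin :=
    { toFun := fun d => d.toLinearMap.rTensor V
      map_add' := fun d e => LinearMap.rTensor_add V d.toLinearMap e.toLinearMap
      map_smul' := fun a d => TensorProduct.ext' fun b v => rfl }
  leibniz d a w := by
    change d.toLinearMap.rTensor V (a • w) = a • d.toLinearMap.rTensor V w + d a • w
    induction w with
    | zero => simp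
    | add x y hx hy =>
      simp only [smul_add, map_add, hx, hy]
      abel
    | tmul b v =>
      rw [TensorProduct.smul_tmul', LinearMap.rTensor_tmul, LinearMap.rTensor_tmul,
        TensorProduct.smul_tmul', TensorProduct.smul_tmul', ← TensorProduct.add_tmul]
      congr 1
      change d (a * b) = a * d b + d a * b
      rw [d.leibniz, smul_eq_mul, smul_eq_mul, mul_comm b]

end Connections

lemma map_smul_tensor {F A V : Type*} [CommRing F] [CommRing A] [Algebra F A] [AddCommGroup V]
    [Module F V] (φ : A →ₐ[F] A) (ψ : V →ₗ[F] V) (a : A) (ha : φ a = a) (w : A ⊗[F] V) :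
    TensorProduct.map φ.toLinearMap ψ (a • w) = a • TensorProduct.map φ.toLinearMap ψ w := by
  induction w with
  | zero => simp
  | add x y hx hy => rw [smul_add, map_add, hx, hy, map_add, smul_add]
  | tmul b v =>
    rw [TensorProduct.smul_tmul', TensorProduct.map_tmul, TensorProduct.map_tmul,
      TensorProduct.smul_tmul', smul_eq_mul, smul_eq_mul, AlgHom.toLinearMap_apply,
      AlgHom.toLinearMap_apply, map_mul, ha]

section Cohomology

/- The Chevalley-Hochschild complex of `L` with values in a module with connection, in the
degrees `1`, `2`, `3` that enter the second cohomology. -/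

variable {F A L M : Type*} [CommRing F] [CommRing A] [Algebra F A]
  [LieRing L] [Module A L] [LieRingModule L A]
  [AddCommGroup M] [Module F M] [Module A M] [IsScalarTower F A M]

variable (F A L M) in
/-- The 2-cochains `Hom_A (L ∧ L, M)`: alternating `A`-bilinear maps. -/
def TwoCochains : Submodule F (L →ₗ[A] L →ₗ[A] M) where
  carrier := {c | ∀ x, c x x = 0}
  add_mem' h k x := by simp [h x, k x]
  zero_mem' x := rfl
  smul_mem' r c h x := by simp [h x]

instance : AddCommGroup (TwoCochains F A L M) := Submodule.addCommGroup _

/-- The 2-cocycles: the `c` with `d² c = 0`. -/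
def twoCocycles (D : Connection F A L M) : Submodule F (TwoCochains F A L M) where
  carrier := {c | ∀ x y z : L,
    D.toLin x (c.1 y z) - D.toLin y (c.1 x z) + D.toLin z (c.1 x y)
      - c.1 ⁅x, y⁆ z + c.1 ⁅x, z⁆ y - c.1 ⁅y, z⁆ x = 0}
  add_mem' {b c} h k x y z := by
    have h' := h x y z
    have k' := k x y z
    simp only [Submodule.coe_add, LinearMap.add_apply, map_add]
    rw [← add_zero (0 : M)]
    nth_rewrite 1 [← h']
    rw [← k']
    abel
  zero_mem' x y z := by simp
  smul_mem' r c h x y z := by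
    have h' := h x y z
    simp only [SetLike.val_smul, LinearMap.smul_apply, map_smul]
    rw [← smul_sub, ← smul_add, ← smul_sub, ← smul_add, ← smul_sub, h', smul_zero]

/-- The 2-coboundaries: the `d¹ b`, for `b` in `Hom_A (L, M)`. -/
def twoCoboundaries (D : Connection F A L M) : Submodule F (TwoCochains F A L M) where
  carrier := {c | ∃ b : L →ₗ[A] M, ∀ x y : L,
    c.1 x y = D.toLin x (b y) - D.toLin y (b x) - b ⁅x, y⁆}
  add_mem' := by
    rintro c c' ⟨b, h⟩ ⟨b', h'⟩
    refine ⟨b + b', fun x y => ?_⟩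
    simp only [Submodule.coe_add, LinearMap.add_apply, map_add, h, h']
    abel
  zero_mem' := ⟨0, fun x y => by simp⟩
  smul_mem' := by
    rintro r c ⟨b, h⟩
    refine ⟨r • b, fun x y => ?_⟩
    simp only [SetLike.val_smul, LinearMap.smul_apply, map_smul, h, smul_sub]

instance (D : Connection F A L M) : AddCommGroup (twoCocycles D) := Submodule.addCommGroup _

/-- The second Chevalley-Hochschild cohomology, cocycles modulo coboundaries. -/
abbrev H2 (D : Connection F A L M) : Type _ :=
  twoCocycles D ⧸ (twoCoboundaries D).comap (twoCocycles D).subtype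

end Cohomology

section KodairaSpencer

variable (F A W : Type*) [CommRing F] [CommRing A] [Algebra F A]
  [AddCommGroup W] [Module F W] [Module A W] [IsScalarTower F A W]

/-- Hochschild 1-cocycles of `A` with values in the bimodule `P = End_F W`, where
`(a p)(w) = a (p w)` and `(p a)(w) = p (a w)`: the maps with `D (a b) = a D(b) + D(a) b`. -/
def hochschildZ1 : Submodule A (A →ₗ[F] Module.End F W) where
  carrier := {D | ∀ (a b : A) (w : W), D (a * b) w = a • D b w + D a (b • w)}
  add_mem' h k a b w := by
    simp only [LinearMap.add_apply, h a b w, k a b w, smul_add]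
    abel
  zero_mem' a b w := by simp
  smul_mem' c D h a b w := by
    change c • D (a * b) w = a • c • D b w + c • D a (b • w)
    rw [h a b w, smul_add, smul_comm c a]

/-- The Hochschild differential `P → C¹`, `p ↦ (a ↦ p a - a p)`. -/
def hochschildD0 : Module.End F W →ₗ[A] (A →ₗ[F] Module.End F W) where
  toFun p := LinearMap.mk₂ F (fun a w => p (a • w) - a • p w)
    (fun a b w => by simp only [add_smul, map_add]; abel)
    (fun r a w => by simp only [smul_assoc, map_smul, smul_sub])
    (fun a v w => by simp only [smul_add, map_add]; abel)
    (fun r a w => by simp only [smul_comm a r, map_smul, smul_sub])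
  map_add' p q := by
    ext a w
    simp only [LinearMap.mk₂_apply, LinearMap.add_apply, smul_add]
    abel
  map_smul' c p := by
    ext a w
    simp only [LinearMap.mk₂_apply, LinearMap.smul_apply, smul_sub, smul_comm a c,
      RingHom.id_apply]

instance : AddCommGroup (hochschildZ1 F A W) := Submodule.addCommGroup _

/-- `HH¹(A, End_F W) = Ext¹_A(W, W)`. -/
abbrev HH1 : Type _ :=
  hochschildZ1 F A W ⧸ (LinearMap.range (hochschildD0 F A W)).comap (hochschildZ1 F A W).subtype

/-- The cocycle `C(δ)(a)(w) = δ(a) w`. -/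
def ksCocycle : Derivation F A A →ₗ[A] hochschildZ1 F A W where
  toFun d := ⟨LinearMap.mk₂ F (fun a w => d a • w)
      (fun a b w => by simp only [map_add, add_smul])
      (fun r a w => by
        change d (r • a) • w = r • d a • w
        rw [Derivation.map_smul, smul_assoc])
      (fun a v w => by simp only [smul_add])
      (fun r a w => by simp only [smul_comm (d a) r]),
    fun a b w => by
      simp only [LinearMap.mk₂_apply, Derivation.leibniz, smul_eq_mul, add_smul, mul_smul,
        smul_comm b (d a)]⟩
  map_add' d e := by
    ext a w
    simp [add_smul]
  map_smul' c d := by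
    ext a w
    simp [mul_smul]

/-- The Kodaira-Spencer map `Der_F A → Ext¹_A(W, W)`. -/
def kodairaSpencer : Derivation F A A →ₗ[A] HH1 F A W :=
  (Submodule.mkQ _).comp (ksCocycle F A W)

lemma mem_ker_kodairaSpencer (d : Derivation F A A) :
    d ∈ LinearMap.ker (kodairaSpencer F A W) ↔
      ∃ p : Module.End F W, ∀ (a : A) (w : W), p (a • w) = a • p w + d a • w := by
  rw [LinearMap.mem_ker, kodairaSpencer, LinearMap.comp_apply, Submodule.mkQ_apply,
    Submodule.Quotient.mk_eq_zero, Submodule.mem_comap, LinearMap.mem_range]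
  refine exists_congr fun p => ⟨fun h a w => ?_, fun h => ?_⟩
  · have := LinearMap.congr_fun (LinearMap.congr_fun h a) w
    have h2 : p (a • w) - a • p w = d a • w := this
    rw [← h2]; abel
  · ext a w
    change p (a • w) - a • p w = d a • w
    rw [h]; abel

/-- The linear Lie-Rinehart algebra `V_W` of `W`: the kernel of the Kodaira-Spencer map. -/
def linearLieRinehart : LieRinehartSubalgebra A (Derivation F A A) where
  __ := LinearMap.ker (kodairaSpencer F A W)
  lie_mem' {d e} hd he := by
    obtain ⟨p, hp⟩ := (mem_ker_kodairaSpencer F A W d).1 hd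
    obtain ⟨q, hq⟩ := (mem_ker_kodairaSpencer F A W e).1 he
    refine (mem_ker_kodairaSpencer F A W _).2 ⟨p * q - q * p, fun a w => ?_⟩
    simp only [LinearMap.sub_apply, Module.End.mul_apply, hp, hq, map_add, smul_sub,
      Derivation.commutator_apply, sub_smul]
    abel

instance : Module A (linearLieRinehart F A W) := (linearLieRinehart F A W).toSubmodule.module

end KodairaSpencer

section Sections

variable {F A : Type*} [CommRing F] [CommRing A] [Algebra F A]

/-- The ring map `B → B[ε]`, for a localization `B` of `A`, that extends
`A → B[ε]`, `a ↦ a + d(a) ε`. -/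
def extendHom (S : Submonoid A) (B : Type*) [CommRing B] [Algebra A B] [IsLocalization S B]
    (d : Derivation F A A) : B →+* DualNumber B :=
  IsLocalization.lift (M := S)
    (g := { toFun := fun a => TrivSqZeroExt.inl (algebraMap A B a)
              + TrivSqZeroExt.inr (algebraMap A B (d a))
            map_one' := by ext <;> simp
            map_zero' := by simp
            map_add' := fun a b => by
              ext
              · simp
              · simp only [map_add, TrivSqZeroExt.snd_add, TrivSqZeroExt.snd_inl,
                  TrivSqZeroExt.snd_inr]
                abel
            map_mul' := fun a b => by
              ext
              · simp
              · simp only [Derivation.leibniz, smul_eq_mul, map_mul, map_add,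
                  TrivSqZeroExt.snd_add, TrivSqZeroExt.snd_inl, TrivSqZeroExt.snd_inr,
                  TrivSqZeroExt.snd_mul, TrivSqZeroExt.fst_add, TrivSqZeroExt.fst_inl,
                  TrivSqZeroExt.fst_inr, MulOpposite.smul_eq_mul_unop, MulOpposite.unop_op]
                ring })
    (fun s => by
      rw [TrivSqZeroExt.isUnit_iff_isUnit_fst]
      simpa using IsLocalization.map_units B s)

section

variable (S : Submonoid A) (B : Type*) [CommRing B] [Algebra A B] [IsLocalization S B]

lemma extendHom_algebraMap (d : Derivation F A A) (a : A) :
    extendHom S B d (algebraMap A B a) = TrivSqZeroExt.inl (algebraMap A B a)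
      + TrivSqZeroExt.inr (algebraMap A B (d a)) := by
  rw [extendHom, IsLocalization.lift_eq]
  rfl

lemma fst_extendHom (d : Derivation F A A) (b : B) : (extendHom S B d b).fst = b := by
  have : (TrivSqZeroExt.fstHom B B B).toRingHom.comp (extendHom S B d) = RingHom.id B := by
    refine IsLocalization.ringHom_ext S (RingHom.ext fun a => ?_)
    simp [extendHom_algebraMap]
  exact RingHom.congr_fun this b

variable [Algebra F B] [IsScalarTower F A B]

/-- The unique extension of a derivation `d` of `A` to a derivation of the localization `B`, given
by the quotient rule `a / s ↦ (s d(a) - a d(s)) / s²`. -/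
def extendDerivation (d : Derivation F A A) : Derivation F B B :=
  Derivation.mk'
    { toFun := fun b => (extendHom S B d b).snd
      map_add' := fun b c => by simp
      map_smul' := fun r b => by
        rw [Algebra.smul_def, IsScalarTower.algebraMap_apply F A B, map_mul,
          extendHom_algebraMap]
        simp [Algebra.smul_def, ← IsScalarTower.algebraMap_apply F A B] }
    (fun b c => by
      simp [fst_extendHom, mul_comm])

@[simp] lemma extendDerivation_algebraMap (d : Derivation F A A) (a : A) :
    extendDerivation S B d (algebraMap A B a) = algebraMap A B (d a) := by
  change (extendHom S B d (algebraMap A B a)).snd = _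
  rw [extendHom_algebraMap]
  simp [Algebra.algebraMap_eq_smul_one]

lemma derivation_localization_ext (S : Submonoid A) (B : Type*) [CommRing B] [Algebra A B]
    [IsLocalization S B] [Algebra F B] [IsScalarTower F A B] (d e : Derivation F B B)
    (h : ∀ a, d (algebraMap A B a) = e (algebraMap A B a)) : d = e := by
  ext b
  obtain ⟨a, s, rfl⟩ := IsLocalization.exists_mk'_eq S b
  have hs := IsLocalization.map_units B s
  have k : ∀ f : Derivation F B B, algebraMap A B s * f (IsLocalization.mk' B a s) =
      f (algebraMap A B a) - IsLocalization.mk' B a s * f (algebraMap A B s) := fun f => by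
    rw [← IsLocalization.mk'_spec' B a s, f.leibniz]
    simp
  exact hs.mul_left_cancel (by rw [k, k, h, h])

lemma extendDerivation_add (d e : Derivation F A A) :
    extendDerivation S B (d + e) = extendDerivation S B d + extendDerivation S B e :=
  derivation_localization_ext S B _ _ fun a => by simp

lemma extendDerivation_smul (c : A) (d : Derivation F A A) :
    extendDerivation S B (c • d) = algebraMap A B c • extendDerivation S B d :=
  derivation_localization_ext S B _ _ fun a => by simp [Algebra.smul_def]

end

lemma extendDerivation_smul_apply (S : Submonoid A) (B : Type*) [CommRing B] [Algebra A B]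
    [IsLocalization S B] [Algebra F B] [IsScalarTower F A B] (d : Derivation F A A) (a : A)
    (b : B) : extendDerivation S B d (a • b) = a • extendDerivation S B d b + d a • b := by
  rw [Algebra.smul_def, Derivation.leibniz, extendDerivation_algebraMap, Algebra.smul_def a,
    Algebra.smul_def (d a), smul_eq_mul, smul_eq_mul, mul_comm b]

lemma extendDerivation_quotient (S : Submonoid A) (B : Type*) [CommRing B] [Algebra A B]
    [IsLocalization S B] [Algebra F B] [IsScalarTower F A B] (d : Derivation F A A) (a s : A)
    (b : B) (h : algebraMap A B s * b = algebraMap A B a) :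
    algebraMap A B (s * s) * extendDerivation S B d b = algebraMap A B (s * d a - a * d s) := by
  have k := congrArg (extendDerivation S B d) h
  simp only [Derivation.leibniz, smul_eq_mul, extendDerivation_algebraMap] at k
  simp only [map_mul, map_sub, ← k, ← h]
  ring

lemma localizedModule_mk_eq_iff {S : Submonoid A} (a : A) (s : S) (y : Localization S) :
    y = (LocalizedModule.mk a s : LocalizedModule S A) ↔
      algebraMap A (Localization S) s * y = algebraMap A (Localization S) a := by
  have : (LocalizedModule.mk a s : LocalizedModule S A) =
      IsLocalization.mk' (Localization S) a s := by
    rw [← Localization.mk_eq_mk']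
    rfl
  rw [this, IsLocalization.eq_mk'_iff_mul_eq, mul_comm]

/-- The ring `Γ(U, O)` of sections of the structure sheaf of `Spec A` over `U`: the functions on `U`
with values in the stalks `A_p` that are locally fractions. -/
def sections (A : Type*) [CommRing A] (U : Opens (PrimeSpectrum A)) :
    Subalgebra A (∀ p : U, Localization.AtPrime p.1.asIdeal) where
  carrier := {s | (StructureSheaf.isLocallyFraction A A).pred s}
  mul_mem' hs ht := (StructureSheaf.sectionsSubalgebra A U).mul_mem hs ht
  add_mem' hs ht := (StructureSheaf.sectionsSubalgebra A U).add_mem hs ht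
  algebraMap_mem' a := (StructureSheaf.sectionsSubalgebra A U).algebraMap_mem a

/-- The connection on `O_U`: a derivation `d` acts on sections by its extension to the stalks. -/
def sectionsConnection (L : LieRinehartSubalgebra A (Derivation F A A))
    (U : Opens (PrimeSpectrum A)) : Connection F A L (sections A U) where
  toLin :=
    { toFun := fun x =>
        { toFun := fun s => ⟨fun p => extendDerivation p.1.asIdeal.primeCompl
              (Localization.AtPrime p.1.asIdeal) x.1 (s.1 p), by
            intro p
            obtain ⟨V, hpV, i, r, t, h⟩ := s.2 p
            refine ⟨V, hpV, i, t * x.1 r - r * x.1 t, t * t, fun q => ?_⟩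
            obtain ⟨ht, hq⟩ := h q
            have hq' := (localizedModule_mk_eq_iff _ _ _).1 hq
            exact ⟨fun h' => (q.1.isPrime.mem_or_mem h').elim ht ht, (localizedModule_mk_eq_iff _ _ _).2
              (extendDerivation_quotient _ _ x.1 r t _ hq')⟩⟩
          map_add' := fun s t => by
            ext p
            exact map_add _ _ _
          map_smul' := fun r s => by
            ext p
            exact Derivation.map_smul _ _ _ }
      map_add' := fun x y => by
        ext s p
        exact DFunLike.congr_fun (extendDerivation_add _ _ x.1 y.1) _
      map_smul' := fun a x => by
        ext s p
        refine (DFunLike.congr_fun (extendDerivation_smul _ _ a x.1) _).trans ?_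
        exact (Algebra.smul_def _ _).symm }
  leibniz x a s := by
    ext p
    exact extendDerivation_smul_apply _ _ x.1 a (s.1 p)

end Sections

section ChernClass

variable (F A W : Type*) [CommRing F] [CommRing A] [Algebra F A]
  [AddCommGroup W] [Module F W] [Module A W] [IsScalarTower F A W]

/-- The open subset `U` of `Spec A` where `W` is locally free of finite rank: the union of the
`D(f)` such that `W_f` is a finite free `A_f`-module. -/
def locallyFreeOpen : Opens (PrimeSpectrum A) where
  carrier := {p | ∃ f : A, f ∉ p.asIdeal ∧
    Module.Free (Localization.Away f) (Localization.Away f ⊗[A] W) ∧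
    Module.Finite (Localization.Away f) (Localization.Away f ⊗[A] W)}
  is_open' := by
    rw [isOpen_iff_forall_mem_open]
    rintro p ⟨f, hf, h⟩
    exact ⟨PrimeSpectrum.basicOpen f, fun q hq => ⟨f, hq, h⟩, PrimeSpectrum.isOpen_basicOpen, hf⟩

lemma trace_atPrime_of_away (f : A) (p : Ideal A) [p.IsPrime] (hf : f ∉ p)
    (h₁ : Module.Free (Localization.Away f) (Localization.Away f ⊗[A] W))
    (h₂ : Module.Finite (Localization.Away f) (Localization.Away f ⊗[A] W))
    (φ : Module.End A W) (r : A) (n : ℕ)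
    (hr : algebraMap A (Localization.Away f) (f ^ n) *
      LinearMap.trace (Localization.Away f) (Localization.Away f ⊗[A] W)
        (φ.baseChange (Localization.Away f)) = algebraMap A (Localization.Away f) r) :
    algebraMap A (Localization.AtPrime p) (f ^ n) *
      LinearMap.trace (Localization.AtPrime p) (Localization.AtPrime p ⊗[A] W)
        (φ.baseChange (Localization.AtPrime p)) = algebraMap A (Localization.AtPrime p) r := by
  let i : Localization.Away f →+* Localization.AtPrime p :=
    IsLocalization.Away.lift f (g := algebraMap A (Localization.AtPrime p))
      (IsLocalization.map_units (Localization.AtPrime p) (⟨f, hf⟩ : p.primeCompl))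
  have hi : ∀ a, i (algebraMap A _ a) = algebraMap A _ a := fun a =>
    IsLocalization.Away.lift_eq f _ a
  let _ : Algebra (Localization.Away f) (Localization.AtPrime p) := i.toAlgebra
  have : IsScalarTower A (Localization.Away f) (Localization.AtPrime p) :=
    IsScalarTower.of_algebraMap_eq fun a => (hi a).symm
  let e := TensorProduct.AlgebraTensorModule.cancelBaseChange A (Localization.Away f)
    (Localization.AtPrime p) (Localization.AtPrime p) W
  have h3 : LinearMap.trace (Localization.AtPrime p) (Localization.AtPrime p ⊗[A] W)
        (φ.baseChange (Localization.AtPrime p)) =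
      i (LinearMap.trace (Localization.Away f) (Localization.Away f ⊗[A] W)
        (φ.baseChange (Localization.Away f))) := by
    refine Eq.trans ?_ (LinearMap.trace_baseChange (φ.baseChange (Localization.Away f))
      (Localization.AtPrime p))
    rw [← LinearMap.trace_conj' _ e]
    congr 1
    ext w
    simp [e, LinearEquiv.conj_apply]
  rw [h3, ← hi, ← hi, ← map_mul, hr]

/-- The trace of an endomorphism of `W`, as a regular function on the locus where `W` is locally
free: at `p` it is the trace of the induced endomorphism of the free `A_p`-module `W_p`. -/
def traceSection : Module.End A W →ₗ[A] sections A (locallyFreeOpen A W) where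
  toFun φ := ⟨fun p => LinearMap.trace (Localization.AtPrime p.1.asIdeal)
      (Localization.AtPrime p.1.asIdeal ⊗[A] W)
      (φ.baseChange (Localization.AtPrime p.1.asIdeal)), by
    rintro ⟨p, f, hf, h₁, h₂⟩
    obtain ⟨n, r, hr⟩ := IsLocalization.Away.surj f
      (LinearMap.trace (Localization.Away f) (Localization.Away f ⊗[A] W)
        (φ.baseChange (Localization.Away f)))
    refine ⟨PrimeSpectrum.basicOpen f, hf,
      CategoryTheory.homOfLE fun q hq => ⟨f, hq, h₁, h₂⟩, r, f ^ n, fun q => ?_⟩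
    have : q.1.asIdeal.IsPrime := q.1.isPrime
    exact ⟨fun h => q.2 (q.1.isPrime.mem_of_pow_mem n h), (localizedModule_mk_eq_iff _ _ _).2
      (trace_atPrime_of_away A W f q.1.asIdeal q.2 h₁ h₂ φ r n (by rw [mul_comm]; simpa using hr))⟩⟩
  map_add' φ ψ := by
    ext p
    exact (congrArg (LinearMap.trace (Localization.AtPrime p.1.asIdeal)
      (Localization.AtPrime p.1.asIdeal ⊗[A] W)) (LinearMap.baseChange_add φ ψ)).trans
        (map_add _ _ _)
  map_smul' a φ := by
    ext p
    exact (congrArg (LinearMap.trace (Localization.AtPrime p.1.asIdeal)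
      (Localization.AtPrime p.1.asIdeal ⊗[A] W)) (LinearMap.baseChange_smul a φ)).trans
        (LinearMap.map_smul_of_tower _ a _)

variable {F A W}

/-- The cochain `trace ∘ R_∇` attached to a `V_W`-connection `∇` on `W`, with values in `O_U`.

Since `V_W|_U` is the restriction of the quasi-coherent sheaf associated to the `A`-module `V_W`,
the `O_U`-linear maps from its exterior powers to `O_U` are the same as the alternating
`A`-multilinear maps from `V_W` to the `A`-module `Γ(U, O_U)`. -/
def chernCochain (D : Connection F A (linearLieRinehart F A W) W) :
    TwoCochains F A (linearLieRinehart F A W) (sections A (locallyFreeOpen A W)) :=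
  ⟨D.curvatureForm.compr₂ (traceSection A W), fun x => by
    have : D.curvature x x = 0 := by
      ext w
      simp
    change traceSection A W (D.curvature x x) = 0
    rw [this, map_zero]⟩

variable (F A W) in
/-- The action of `V_W` on `O_U`. -/
abbrev structureConnection :
    Connection F A (linearLieRinehart F A W) (sections A (locallyFreeOpen A W)) :=
  sectionsConnection (linearLieRinehart F A W) (locallyFreeOpen A W)

/-- The first Chern class `c₁(W)` in `H²(V_W|_U, O_U)`, computed with the connection `D`: the class
of the cocycle `trace ∘ R_D`. -/
def firstChernClass (D : Connection F A (linearLieRinehart F A W) W)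
    (hD : chernCochain D ∈ twoCocycles (structureConnection F A W)) :
    H2 (structureConnection F A W) :=
  Submodule.Quotient.mk ⟨chernCochain D, hD⟩

variable (F A W) in
/-- `c₁(W) = 0`: the module `W` has a `V_W`-connection, and whichever `V_W`-connection is used to
compute it, the class `c₁(W)` in `H²(V_W|_U, O_U)` is zero. -/
def FirstChernClassVanishes : Prop :=
  Nonempty (Connection F A (linearLieRinehart F A W) W) ∧
    ∀ D : Connection F A (linearLieRinehart F A W) W,
      ∃ hD : chernCochain D ∈ twoCocycles (structureConnection F A W), firstChernClass D hD = 0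

end ChernClass

section Quotient

/-- The coordinate ring `ℂ[x, y]` of the plane. -/
abbrev PlaneRing : Type := MvPolynomial (Fin 2) ℂ

/-- The action of `g` in `GL(2, ℂ)` on functions on `ℂ²`: `(g a)(v) = a (g⁻¹ v)`. -/
def polyAct (g : GL (Fin 2) ℂ) : PlaneRing →ₐ[ℂ] PlaneRing :=
  MvPolynomial.aeval fun i => ∑ j, MvPolynomial.C ((g⁻¹ : GL (Fin 2) ℂ).1 i j) * MvPolynomial.X j

lemma polyAct_X (g : GL (Fin 2) ℂ) (i : Fin 2) : polyAct g (MvPolynomial.X i) =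
    ∑ j, MvPolynomial.C ((g⁻¹ : GL (Fin 2) ℂ).1 i j) * MvPolynomial.X j :=
  MvPolynomial.aeval_X _ _

lemma polyAct_mul (g h : GL (Fin 2) ℂ) (a : PlaneRing) :
    polyAct (g * h) a = polyAct g (polyAct h a) := by
  have : polyAct (g * h) = (polyAct g).comp (polyAct h) := by
    refine MvPolynomial.algHom_ext fun i => ?_
    rw [AlgHom.comp_apply, polyAct_X, polyAct_X, mul_inv_rev]
    simp only [map_mul, polyAct_X, Units.val_mul, Matrix.mul_apply,
      MvPolynomial.algHom_C, MvPolynomial.algebraMap_eq, Fin.sum_univ_two, map_add]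
    ring
  exact AlgHom.congr_fun this a

lemma polyAct_one (a : PlaneRing) : polyAct 1 a = a := by
  have : polyAct 1 = AlgHom.id ℂ PlaneRing := by
    refine MvPolynomial.algHom_ext fun i => ?_
    rw [polyAct_X]
    fin_cases i <;> simp
  exact AlgHom.congr_fun this a

/-- `g` is a pseudo-reflection: its fixed points on `ℂ²` form a line. -/
def IsPseudoReflection (g : GL (Fin 2) ℂ) : Prop :=
  (g.1 - 1 : Matrix (Fin 2) (Fin 2) ℂ).rank = 1

variable (G : Subgroup (GL (Fin 2) ℂ))

/-- The invariant ring `A^G`. -/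
def invariantRing : Subalgebra ℂ PlaneRing where
  carrier := {a | ∀ g ∈ G, polyAct g a = a}
  mul_mem' ha hb g hg := by rw [map_mul, ha g hg, hb g hg]
  add_mem' ha hb g hg := by rw [map_add, ha g hg, hb g hg]
  algebraMap_mem' r g _ := AlgHom.commutes _ _

/- Shortcuts for instance search. -/

instance : Module (invariantRing G) PlaneRing := (invariantRing G).moduleLeft

instance : SMulCommClass ℂ (invariantRing G) PlaneRing := inferInstance

instance : Module (invariantRing G) (Derivation ℂ PlaneRing PlaneRing) := Derivation.instModule

instance : Module (invariantRing G) (invariantRing G) := Semiring.toModule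

instance : Module (invariantRing G) (Derivation ℂ (invariantRing G) (invariantRing G)) :=
  Derivation.instModule

/-- The derivations `δ` of `A` with `g ∘ δ ∘ g⁻¹ = δ` for all `g` in `G`. -/
def invariantDerivations : LieRinehartSubalgebra (invariantRing G) (Derivation ℂ PlaneRing PlaneRing) where
  carrier := {d | ∀ g ∈ G, ∀ a, polyAct g (d (polyAct g⁻¹ a)) = d a}
  add_mem' hd he g hg a := by
    rw [Derivation.add_apply, map_add, hd g hg, he g hg, Derivation.add_apply]
  zero_mem' g _ a := by
    rw [Derivation.zero_apply, map_zero, Derivation.zero_apply]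
  smul_mem' b d hd g hg a := by
    change polyAct g ((b : PlaneRing) * d (polyAct g⁻¹ a)) = (b : PlaneRing) * d a
    rw [map_mul, hd g hg, b.2 g hg]
  lie_mem' {d e} hd he g hg a := by
    have key : ∀ f : Derivation ℂ PlaneRing PlaneRing, (∀ g ∈ G, ∀ a, polyAct g (f (polyAct g⁻¹ a)) = f a) →
        ∀ b, polyAct g (f b) = f (polyAct g b) := fun f hf b => by
      rw [← hf g hg (polyAct g b), ← polyAct_mul, inv_mul_cancel, polyAct_one]
    rw [Derivation.commutator_apply, map_sub, key d hd, key e he, key e he, key d hd,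
      ← polyAct_mul, mul_inv_cancel, polyAct_one, Derivation.commutator_apply]

instance : Module (invariantRing G) (invariantDerivations G) :=
  (invariantDerivations G).toSubmodule.module

variable {V : Type*} [AddCommGroup V] [Module ℂ V]

instance : Module (invariantRing G) (PlaneRing ⊗[ℂ] V) := TensorProduct.leftModule

/-- The module `(V ⊗ A)^G` of invariants for the action `g (v ⊗ a) = ρ(g) v ⊗ g a`; the tensor
factors are written in the order `A ⊗ V`. -/
def invariantModule (ρ : Representation ℂ G V) : Submodule (invariantRing G) (PlaneRing ⊗[ℂ] V) where
  carrier := {w | ∀ g : G, TensorProduct.map (polyAct g.1).toLinearMap (ρ g) w = w}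
  add_mem' hv hw g := by rw [map_add, hv g, hw g]
  zero_mem' g := map_zero _
  smul_mem' b w hw g := by
    exact (map_smul_tensor (polyAct g.1) (ρ g) b.1 (b.2 g.1 g.2) w).trans
      (congrArg (b.1 • ·) (hw g))

instance (ρ : Representation ℂ G V) : AddCommGroup (invariantModule G ρ) :=
  (invariantModule G ρ).addCommGroup

instance (ρ : Representation ℂ G V) : Module (invariantRing G) (invariantModule G ρ) :=
  (invariantModule G ρ).module

instance (ρ : Representation ℂ G V) : SMul (invariantRing G) (invariantModule G ρ) :=
  (inferInstance : Module (invariantRing G) (invariantModule G ρ)).toSMul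

instance (ρ : Representation ℂ G V) : IsScalarTower ℂ (invariantRing G) (invariantModule G ρ) :=
  ⟨fun r b w => Subtype.ext (smul_assoc r (b : PlaneRing) (w : PlaneRing ⊗[ℂ] V))⟩

end Quotient

end LRChern

open LRChern

/-! The substance is that every derivation of `A^G` lifts to an invariant derivation of `A`. Without
pseudo-reflections `G` acts freely off the origin, so near each `v ≠ 0` the quotient map is étale:
some two invariants have a Jacobian that does not vanish at `v` (`exists_jacobian_eval_ne_zero`). A
derivation `δ` of `A^G` is therefore a vector field off the origin, and it extends over the origin
because a point has codimension two.

This is made algebraic as follows. Any three invariants are algebraically dependent, so the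
determinant of `δ, ∂₀, ∂₁` on them is zero. Expanding it writes `J δ` as a polynomial vector field
`P ∂₀ + Q ∂₁`, with `J` the Jacobian of two invariants. The Jacobians of invariants have no common
zero off the origin, hence by the Nullstellensatz no common factor, and `J` divides `P` and `Q`
(`dvd_of_dvd_mul_jacobian`). A derivation of `A` that kills `A^G` is zero; this gives uniqueness of
the lift, and with it invariance.

The connection `d ⊗ 1` is flat and commutes with `G` for invariant `d`, so it restricts to a flat
connection `D` on `W_ρ`. For any other connection `E = D + φ`, the curvature is the covariant
exterior derivative of `φ` plus the commutator `[φ, φ]`. The trace kills commutators and turns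
`[∇_x, φ]` into `x (tr φ)`, so `tr R_E` is the coboundary of `tr φ`
(`chernCochain_mem_twoCoboundaries`). -/

namespace LRChern

/-! ### Derivations and algebraic dependence -/

open MvPolynomial in
/-- The chain rule for a derivation applied to a polynomial expression. -/
lemma derivation_aeval {R B M σ : Type*} [CommRing R] [CommRing B] [Algebra R B] [AddCommGroup M]
    [Module R M] [Module B M] [IsScalarTower R B M] [Fintype σ] (D : Derivation R B M) (b : σ → B)
    (F : MvPolynomial σ R) :
    D (aeval b F) = ∑ i, aeval b (pderiv i F) • D (b i) := by
  classical
  induction F using MvPolynomial.induction_on with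
  | C a => simp [MvPolynomial.algHom_C]
  | add p q hp hq => simp only [map_add, hp, hq, add_smul, Finset.sum_add_distrib]
  | mul_X p j hp =>
    have h : aeval b p • D (b j) = ∑ i, aeval b (p * pderiv i (X j)) • D (b i) := by
      rw [Finset.sum_eq_single j (fun i _ hi => by simp [pderiv_X_of_ne hi.symm])
        (fun h => (h (Finset.mem_univ j)).elim)]
      simp
    rw [map_mul, aeval_X, Derivation.leibniz, hp, h, Finset.smul_sum, ← Finset.sum_add_distrib]
    refine Finset.sum_congr rfl fun i _ => ?_
    rw [pderiv_mul, map_add, add_smul, ← mul_smul, map_mul _ (pderiv i p), aeval_X,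
      mul_comm (b j), add_comm]

open MvPolynomial in
lemma totalDegree_pderiv_lt {R σ : Type*} [CommRing R] (F : MvPolynomial σ R) (i : σ)
    (h : pderiv i F ≠ 0) : (pderiv i F).totalDegree < F.totalDegree := by
  obtain ⟨m, hm, hd⟩ := Finset.exists_mem_eq_sup (pderiv i F).support
    (support_nonempty.2 h) (fun s => s.sum fun _ e => e)
  rw [totalDegree, hd]
  rw [mem_support_iff, coeff_pderiv] at hm
  have h2 := le_totalDegree (mem_support_iff.2 (left_ne_zero_of_mul hm))
  rw [Finsupp.sum_add_index' (fun _ => rfl) (fun _ _ _ => rfl), Finsupp.sum_single_index rfl] at h2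
  omega

open MvPolynomial in
lemma eq_C_of_pderiv_eq_zero {R σ : Type*} [CommRing R] [IsDomain R] [CharZero R]
    (F : MvPolynomial σ R) (h : ∀ i, pderiv i F = 0) : F = C (coeff 0 F) := by
  classical
  ext m
  rw [coeff_C]
  split_ifs with hm
  · rw [hm]
  · obtain ⟨i, hi⟩ : ∃ i, m i ≠ 0 := by
      by_contra! hc
      exact hm (Finsupp.ext fun i => (hc i).symm)
    -- Subtraction of exponents is truncated; `m i ≠ 0` makes `m - eᵢ` a true predecessor of `m`.
    -- The coefficient of `∂ᵢ F` there is `m i` times that of `F` at `m`, and `m i` is invertible up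
    -- to torsion in characteristic zero.
    have hs : m - Finsupp.single i 1 + Finsupp.single i 1 = m :=
      tsub_add_cancel_of_le (Finsupp.single_le_iff.2 (Nat.one_le_iff_ne_zero.2 hi))
    have := coeff_pderiv (i := i) F (m - Finsupp.single i 1)
    rw [h i, coeff_zero, hs] at this
    refine (mul_eq_zero.1 this.symm).resolve_right ?_
    exact Nat.cast_add_one_ne_zero _

open MvPolynomial in
/-- Algebraically dependent elements satisfy a relation one of whose partial derivatives does not
vanish on them. -/
lemma exists_relation_pderiv_ne_zero {R B σ : Type*} [CommRing R] [IsDomain R] [CharZero R]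
    [CommRing B] [Algebra R B] [FaithfulSMul R B] (b : σ → B) (hb : ¬ AlgebraicIndependent R b) :
    ∃ F : MvPolynomial σ R, aeval b F = 0 ∧ ∃ i, aeval b (pderiv i F) ≠ 0 := by
  -- Descent on the degree: if all partial derivatives of a relation vanish at `b`, a nonzero one is
  -- a relation of smaller degree. The descent ends because a nonzero constant is not a relation.
  have key : ∀ n (F : MvPolynomial σ R), F.totalDegree = n → F ≠ 0 → aeval b F = 0 →
      ∃ F : MvPolynomial σ R, aeval b F = 0 ∧ ∃ i, aeval b (pderiv i F) ≠ 0 := by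
    intro n
    induction n using Nat.strong_induction_on with
    | _ n ih =>
      intro F hn h0 hF
      by_cases hi : ∃ i, aeval b (pderiv i F) ≠ 0
      · exact ⟨F, hF, hi⟩
      push Not at hi
      by_cases hz : ∀ i, pderiv i F = 0
      · rw [eq_C_of_pderiv_eq_zero F hz, algHom_C,
          map_eq_zero_iff _ (FaithfulSMul.algebraMap_injective R B)] at hF
        rw [eq_C_of_pderiv_eq_zero F hz, hF, C_0] at h0
        exact absurd rfl h0
      push Not at hz
      obtain ⟨i, hz⟩ := hz
      exact ih _ (hn ▸ totalDegree_pderiv_lt F i hz) _ rfl hz (hi i)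
  rw [algebraicIndependent_iff] at hb
  push Not at hb
  obtain ⟨F, hF, h0⟩ := hb
  exact key _ F rfl h0 hF

/-- In a domain of transcendence degree less than `n`, the values of `n` derivations at `n`
elements have zero determinant. -/
lemma det_derivation_eq_zero {R A n : Type*} [CommRing R] [IsDomain R] [CharZero R]
    [CommRing A] [IsDomain A] [Algebra R A] [FaithfulSMul R A] [Fintype n] [DecidableEq n]
    (B : Subalgebra R A) (D : n → Derivation R B A) (b : n → B)
    (hb : ¬ AlgebraicIndependent R fun i => (b i : A)) :
    (Matrix.of fun i j => D i (b j)).det = 0 := by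
  obtain ⟨F, hF, i, hi⟩ := exists_relation_pderiv_ne_zero b
    fun h => hb (h.map' (f := B.val) Subtype.val_injective)
  rw [← Matrix.exists_mulVec_eq_zero_iff]
  -- The kernel vector is the gradient of the relation at `b`; the chain rule applied to `F(b) = 0`
  -- says that each row annihilates it.
  refine ⟨fun j => (MvPolynomial.aeval b (MvPolynomial.pderiv j F) : B), fun h => hi ?_, ?_⟩
  · exact Subtype.ext (congrFun h i)
  · ext k
    have := derivation_aeval (D k) b F
    rw [hF, map_zero] at this
    rw [Matrix.mulVec, dotProduct, Pi.zero_apply, this]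
    exact Finset.sum_congr rfl fun j _ => mul_comm _ _

lemma not_algebraicIndependent_plane (b : Fin 3 → PlaneRing) : ¬ AlgebraicIndependent ℂ b := by
  intro h
  have := h.lift_cardinalMk_le_trdeg
  rw [MvPolynomial.trdeg_of_isDomain] at this
  simp at this
  norm_num at this

end LRChern

namespace LRChern

/-! ### The free action off the origin and Jacobians of invariants -/

section Plane

open MvPolynomial

/-- The Jacobian determinant of two functions on the plane. -/
def jacobian (a b : PlaneRing) : PlaneRing :=
  pderiv 0 a * pderiv 1 b - pderiv 1 a * pderiv 0 b

lemma eval_polyAct (g : Matrix.GeneralLinearGroup (Fin 2) ℂ) (v : Fin 2 → ℂ) (a : PlaneRing) :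
    eval v (polyAct g a) =
      eval ((g⁻¹ : Matrix.GeneralLinearGroup (Fin 2) ℂ).1.mulVec v) a := by
  have : (aeval v).comp (polyAct g) =
      aeval ((g⁻¹ : Matrix.GeneralLinearGroup (Fin 2) ℂ).1.mulVec v) := by
    refine algHom_ext fun i => ?_
    rw [AlgHom.comp_apply, polyAct_X, map_sum, aeval_X]
    simp [Matrix.mulVec, dotProduct]
  exact AlgHom.congr_fun this a

/-- Chain rule for a linear substitution. It serves to show that the gradient of `polyAct g a`
vanishes at `v` once that of `a` vanishes at `g⁻¹ v`. -/
lemma pderiv_polyAct (g : Matrix.GeneralLinearGroup (Fin 2) ℂ) (i : Fin 2) (a : PlaneRing) :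
    pderiv i (polyAct g a) =
      ∑ j, C ((g⁻¹ : Matrix.GeneralLinearGroup (Fin 2) ℂ).1 j i) * polyAct g (pderiv j a) := by
  refine (derivation_aeval (pderiv i) _ a).trans (Finset.sum_congr rfl fun j _ => ?_)
  rw [map_sum, Finset.sum_eq_single i (fun k _ hk => by simp [pderiv_X_of_ne hk])
    (fun h => (h (Finset.mem_univ i)).elim)]
  rw [pderiv_C_mul, pderiv_X_self, mul_one, smul_eq_mul, mul_comm]
  rfl

variable (G : Subgroup (Matrix.GeneralLinearGroup (Fin 2) ℂ))

lemma sum_polyAct_mem [Fintype G] (a : PlaneRing) :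
    ∑ g : G, polyAct g.1 a ∈ invariantRing G := by
  intro k hk
  rw [map_sum]
  simp only [← polyAct_mul]
  exact Fintype.sum_equiv (Equiv.mulLeft (⟨k, hk⟩ : G)) _ _ fun g => rfl

/-- A finite linear group without pseudo-reflections acts freely away from the origin. -/
lemma eq_one_of_mulVec_eq (hG : ∀ g ∈ G, ¬ IsPseudoReflection g)
    (g : Matrix.GeneralLinearGroup (Fin 2) ℂ) (hg : g ∈ G) (v : Fin 2 → ℂ) (hv : v ≠ 0)
    (h : g.1.mulVec v = v) : g = 1 := by
  have h0 : (g.1 - 1).mulVec v = 0 := by rw [Matrix.sub_mulVec, h, Matrix.one_mulVec, sub_self]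
  have hker : 0 < Module.finrank ℂ (LinearMap.ker (g.1 - 1).mulVecLin) := by
    rw [Module.finrank_pos_iff_exists_ne_zero]
    exact ⟨⟨v, h0⟩, fun h' => hv (congrArg Subtype.val h')⟩
  have hadd := (g.1 - 1).mulVecLin.finrank_range_add_finrank_ker
  rw [Module.finrank_fin_fun] at hadd
  -- A fixed vector bounds the rank of `g - 1` by `1`, and rank `1` is excluded.
  have hr : Module.finrank ℂ (LinearMap.range (g.1 - 1).mulVecLin) = 0 := by
    have : Module.finrank ℂ (LinearMap.range (g.1 - 1).mulVecLin) ≠ 1 := hG g hg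
    omega
  rw [Submodule.finrank_eq_zero, LinearMap.range_eq_bot, ← Matrix.toLin'_apply',
    LinearEquiv.map_eq_zero_iff] at hr
  exact Units.ext (sub_eq_zero.1 hr)

/-- The points `g⁻¹ v` with `g ≠ 1` differ from `v`, so some `u` vanishes at all of them and not at
`v`. Averaging `(x_k - v_k) u²` over `G` gives an invariant whose gradient at `v` comes from `g = 1`
alone: the square kills first derivatives at the other points. The constant is `c = u(v)²`. -/
lemma exists_invariant_pderiv_eval (hG : ∀ g ∈ G, ¬ IsPseudoReflection g) [Finite G]
    (v : Fin 2 → ℂ) (hv : v ≠ 0) :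
    ∃ c : ℂ, c ≠ 0 ∧ ∀ k : Fin 2, ∃ b ∈ invariantRing G,
      ∀ i, eval v (pderiv i b) = if i = k then c else 0 := by
  classical
  have := Fintype.ofFinite G
  have hfree : ∀ g : G, g ≠ 1 → ∃ k : Fin 2, v k ≠ (g⁻¹.1.1.mulVec v) k := by
    intro g hg
    by_contra! hc
    refine hg (inv_eq_one.1 (Subtype.ext ?_))
    exact eq_one_of_mulVec_eq G hG _ g⁻¹.2 v hv (funext fun k => (hc k).symm)
  choose! κ hκ using hfree
  -- One linear factor for each `g ≠ 1`, in a coordinate `κ g` that separates `v` from `g⁻¹ v`.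
  let u : PlaneRing := ∏ g ∈ Finset.univ.erase (1 : G), (X (κ g) - C ((g⁻¹.1.1.mulVec v) (κ g)))
  have hu : eval v u ≠ 0 := by
    simp only [u, map_prod, map_sub, eval_X, eval_C]
    exact Finset.prod_ne_zero_iff.2 fun g hg => sub_ne_zero.2 (hκ g (Finset.ne_of_mem_erase hg))
  have hu0 : ∀ g : G, g ≠ 1 → eval (g⁻¹.1.1.mulVec v) u = 0 := by
    intro g hg
    simp only [u, map_prod]
    refine Finset.prod_eq_zero (Finset.mem_erase.2 ⟨hg, Finset.mem_univ g⟩) ?_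
    simp
  refine ⟨eval v u ^ 2, pow_ne_zero 2 hu, fun k => ⟨_, sum_polyAct_mem G
    ((X k - C (v k)) * u ^ 2), fun i => ?_⟩⟩
  rw [map_sum, map_sum, Finset.sum_eq_single (1 : G)]
  · simp only [OneMemClass.coe_one, polyAct_one, pderiv_mul, map_sub, pderiv_C, pderiv_X, map_add,
      map_mul, map_pow, eval_X, eval_C, sub_self, zero_mul, add_zero, sub_zero]
    by_cases h : i = k
    · subst h; simp
    · simp [h]
  · intro g _ hg
    rw [pderiv_polyAct, map_sum]
    refine Finset.sum_eq_zero fun j _ => ?_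
    have h0 := hu0 g hg
    rw [map_mul, eval_polyAct]
    have : (g.1⁻¹ : Matrix.GeneralLinearGroup (Fin 2) ℂ).1.mulVec v = g⁻¹.1.1.mulVec v := rfl
    rw [this, pderiv_mul, pderiv_pow, map_add, map_mul, map_mul, map_mul, map_mul, map_pow,
      map_pow, h0]
    simp
  · exact fun h => (h (Finset.mem_univ _)).elim

lemma exists_jacobian_eval_ne_zero (hG : ∀ g ∈ G, ¬ IsPseudoReflection g) [Finite G]
    (v : Fin 2 → ℂ) (hv : v ≠ 0) :
    ∃ b ∈ invariantRing G, ∃ c ∈ invariantRing G, eval v (jacobian b c) ≠ 0 := by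
  obtain ⟨r, hr, h⟩ := exists_invariant_pderiv_eval G hG v hv
  obtain ⟨b, hb, hb'⟩ := h 0
  obtain ⟨c, hc, hc'⟩ := h 1
  refine ⟨b, hb, c, hc, ?_⟩
  simp only [jacobian, map_sub, map_mul, hb', hc']
  simpa using hr

/-- A polynomial on the plane without zeros outside of the origin is a constant. -/
lemma isUnit_of_zeros_subset (f : PlaneRing) (h : ∀ v, eval v f = 0 → v = 0) : IsUnit f := by
  -- By the Nullstellensatz both coordinates lie in the radical of `(f)`; then `f` divides powers of
  -- `x` and of `y`, which are relatively prime.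
  have hX : ∀ i, ∃ n, f ∣ (X i : PlaneRing) ^ n := by
    intro i
    have : (X i : PlaneRing) ∈ (Ideal.span {f}).radical := by
      rw [← vanishingIdeal_zeroLocus_eq_radical (K := ℂ)]
      intro v hv
      rw [h v (by simpa [aeval_eq_eval] using hv f (Ideal.mem_span_singleton_self f))]
      simp
    obtain ⟨n, hn⟩ := this
    exact ⟨n, Ideal.mem_span_singleton.1 hn⟩
  obtain ⟨n, hn⟩ := hX 0
  obtain ⟨m, hm⟩ := hX 1
  have hrel : IsRelPrime ((X 0 : PlaneRing) ^ n) ((X 1 : PlaneRing) ^ m) := by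
    refine IsRelPrime.pow ?_
    rw [Irreducible.isRelPrime_iff_not_dvd (X_prime (i := 0)).irreducible]
    rw [X_dvd_X]
    simp
  exact hrel hn hm

end Plane

end LRChern

namespace LRChern

/-! ### Derivations of the invariant ring as invariant vector fields -/

section Restriction

open MvPolynomial

lemma derivation_plane_apply (d : Derivation ℂ PlaneRing PlaneRing) (a : PlaneRing) :
    d a = d (X 0) * pderiv 0 a + d (X 1) * pderiv 1 a := by
  have := derivation_aeval d (X : Fin 2 → PlaneRing) a
  simpa [aeval_X_left_apply, Fin.sum_univ_two, mul_comm] using this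

variable (G : Subgroup (Matrix.GeneralLinearGroup (Fin 2) ℂ))

lemma exists_jacobian_ne_zero (hG : ∀ g ∈ G, ¬ IsPseudoReflection g) [Finite G] :
    ∃ b c : invariantRing G, jacobian b c ≠ 0 := by
  -- The point `1 = (1, 1)` stands for any nonzero point.
  obtain ⟨b, hb, c, hc, h⟩ := exists_jacobian_eval_ne_zero G hG 1 one_ne_zero
  exact ⟨⟨b, hb⟩, ⟨c, hc⟩, fun h0 => h (by rw [h0, map_zero])⟩

/-- A derivation of `ℂ[x, y]` that kills the invariants is zero. -/
lemma derivation_eq_zero_of_invariantRing (hG : ∀ g ∈ G, ¬ IsPseudoReflection g) [Finite G]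
    (d : Derivation ℂ PlaneRing PlaneRing) (h : ∀ b : invariantRing G, d b = 0) : d = 0 := by
  obtain ⟨b, c, hJ⟩ := exists_jacobian_ne_zero G hG
  have hb := h b
  have hc := h c
  rw [derivation_plane_apply] at hb hc
  -- Cramer's rule: `d x` and `d y` solve a homogeneous linear system with determinant `jacobian b c
  -- ≠ 0`.
  refine derivation_ext (Fin.forall_fin_two.2 ⟨?_, ?_⟩) <;> rw [Derivation.zero_apply] <;>
    refine (mul_eq_zero.1 ?_).resolve_right hJ <;> unfold jacobian
  · linear_combination pderiv 1 (c : PlaneRing) * hb - pderiv 1 (b : PlaneRing) * hc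
  · linear_combination pderiv 0 (b : PlaneRing) * hc - pderiv 0 (c : PlaneRing) * hb

/-- The Jacobians of invariants have no common factor. -/
lemma dvd_of_dvd_mul_jacobian (hG : ∀ g ∈ G, ¬ IsPseudoReflection g) [Finite G]
    (J P : PlaneRing) (hJ : J ≠ 0) (h : ∀ b c : invariantRing G, J ∣ P * jacobian b c) :
    J ∣ P := by
  obtain ⟨J', P', r, hrel, hJ', hP'⟩ := UniqueFactorizationMonoid.exists_reduced_factors J hJ P
  have hr : r ≠ 0 := by
    rintro rfl
    exact hJ (by rw [← hJ', zero_mul])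
  have hdvd : ∀ b c : invariantRing G, J' ∣ jacobian b c := by
    intro b c
    have := h b c
    rw [← hJ', ← hP', mul_assoc, mul_dvd_mul_iff_left hr] at this
    exact hrel.dvd_of_dvd_mul_left this
  -- After the common factor `r` is removed, `J'` divides every Jacobian of invariants, so it can
  -- vanish only at the origin.
  have hu : IsUnit J' := by
    refine isUnit_of_zeros_subset J' fun v hv => ?_
    by_contra hv0
    obtain ⟨b, hb, c, hc, hbc⟩ := exists_jacobian_eval_ne_zero G hG v hv0
    obtain ⟨s, hs⟩ := hdvd ⟨b, hb⟩ ⟨c, hc⟩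
    refine hbc ?_
    change jacobian b c = _ at hs
    rw [hs, map_mul, hv, zero_mul]
  rw [← hJ', ← hP']
  exact mul_dvd_mul_left r hu.dvd

/-- Every derivation of the invariant ring is the restriction of a polynomial vector field. -/
lemma exists_vectorField (hG : ∀ g ∈ G, ¬ IsPseudoReflection g) [Finite G]
    (δ : Derivation ℂ (invariantRing G) (invariantRing G)) :
    ∃ p q : PlaneRing, ∀ b : invariantRing G,
      (δ b : PlaneRing) = p * pderiv 0 (b : PlaneRing) + q * pderiv 1 (b : PlaneRing) := by
  obtain ⟨b₁, b₂, hJ⟩ := exists_jacobian_ne_zero G hG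
  let D : Fin 3 → Derivation ℂ (invariantRing G) PlaneRing :=
    ![(Algebra.linearMap (invariantRing G) PlaneRing).compDer δ,
      (pderiv (R := ℂ) (0 : Fin 2)).compAlgebraMap (invariantRing G),
      (pderiv (R := ℂ) (1 : Fin 2)).compAlgebraMap (invariantRing G)]
  set J := jacobian b₁ b₂ with hJdef
  set P : PlaneRing := δ b₁ * pderiv 1 (b₂ : PlaneRing) - δ b₂ * pderiv 1 (b₁ : PlaneRing) with hP
  set Q : PlaneRing := δ b₂ * pderiv 0 (b₁ : PlaneRing) - δ b₁ * pderiv 0 (b₂ : PlaneRing) with hQ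
  -- Expansion of the vanishing 3 × 3 determinant of `δ, ∂₀, ∂₁` on `b, b₁, b₂`; the fields `P` and
  -- `Q` are the Cramer numerators.
  have key : ∀ b : invariantRing G, J * (δ b : PlaneRing) =
      P * pderiv 0 (b : PlaneRing) + Q * pderiv 1 (b : PlaneRing) := by
    intro b
    have h := det_derivation_eq_zero (invariantRing G) D ![b, b₁, b₂]
      (not_algebraicIndependent_plane _)
    rw [Matrix.det_fin_three] at h
    have h' : (δ b : PlaneRing) * pderiv 0 (b₁ : PlaneRing) * pderiv 1 (b₂ : PlaneRing)
        - δ b * pderiv 0 (b₂ : PlaneRing) * pderiv 1 (b₁ : PlaneRing)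
        - δ b₁ * pderiv 0 (b : PlaneRing) * pderiv 1 (b₂ : PlaneRing)
        + δ b₁ * pderiv 0 (b₂ : PlaneRing) * pderiv 1 (b : PlaneRing)
        + δ b₂ * pderiv 0 (b : PlaneRing) * pderiv 1 (b₁ : PlaneRing)
        - δ b₂ * pderiv 0 (b₁ : PlaneRing) * pderiv 1 (b : PlaneRing) = 0 := h
    rw [hJdef, hP, hQ, jacobian]
    linear_combination h'
  -- Eliminating `Q` from `key b` and `key c` exhibits `P * jacobian b c` as a multiple of `J`; for
  -- `Q` below, `P` is eliminated.
  obtain ⟨p, hp⟩ : J ∣ P := dvd_of_dvd_mul_jacobian G hG J P hJ fun b c =>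
    ⟨δ b * pderiv 1 (c : PlaneRing) - δ c * pderiv 1 (b : PlaneRing), by
      rw [jacobian]
      linear_combination pderiv 1 (b : PlaneRing) * key c - pderiv 1 (c : PlaneRing) * key b⟩
  obtain ⟨q, hq⟩ : J ∣ Q := dvd_of_dvd_mul_jacobian G hG J Q hJ fun b c =>
    ⟨δ c * pderiv 0 (b : PlaneRing) - δ b * pderiv 0 (c : PlaneRing), by
      rw [jacobian]
      linear_combination pderiv 0 (c : PlaneRing) * key b - pderiv 0 (b : PlaneRing) * key c⟩
  refine ⟨p, q, fun b => mul_left_cancel₀ hJ ?_⟩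
  rw [key, hp, hq]
  ring

lemma polyAct_derivation {d : Derivation ℂ PlaneRing PlaneRing} (hd : d ∈ invariantDerivations G)
    {g : Matrix.GeneralLinearGroup (Fin 2) ℂ} (hg : g ∈ G) (a : PlaneRing) :
    polyAct g (d a) = d (polyAct g a) := by
  rw [← hd g hg (polyAct g a), ← polyAct_mul, inv_mul_cancel, polyAct_one]

/-- The conjugate `g ∘ d ∘ g⁻¹` of a derivation. -/
def conjDerivation (g : Matrix.GeneralLinearGroup (Fin 2) ℂ)
    (d : Derivation ℂ PlaneRing PlaneRing) : Derivation ℂ PlaneRing PlaneRing :=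
  Derivation.mk' ((polyAct g).toLinearMap ∘ₗ d.toLinearMap ∘ₗ (polyAct g⁻¹).toLinearMap)
    fun a b => by
      change polyAct g (d (polyAct g⁻¹ (a * b))) =
        a • polyAct g (d (polyAct g⁻¹ b)) + b • polyAct g (d (polyAct g⁻¹ a))
      simp only [map_mul, Derivation.leibniz, map_add, smul_eq_mul, ← polyAct_mul, mul_inv_cancel,
        polyAct_one]

/-- Restriction of invariant derivations to the invariant ring. -/
def restrictDerivation : invariantDerivations G →ₗ[invariantRing G]
    Derivation ℂ (invariantRing G) (invariantRing G) where
  toFun d := Derivation.mk'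
    { toFun := fun b => ⟨d.1 b, fun g hg => by rw [polyAct_derivation G d.2 hg, b.2 g hg]⟩
      map_add' := fun b c => Subtype.ext (d.1.map_add _ _)
      map_smul' := fun r b => Subtype.ext (d.1.map_smul _ _) }
    fun b c => Subtype.ext (d.1.leibniz _ _)
  map_add' d e := by
    ext b
    rfl
  map_smul' c d := by
    ext b
    rfl

lemma restrictDerivation_apply (d : invariantDerivations G) (b : invariantRing G) :
    (restrictDerivation G d b : PlaneRing) = d.1 b := rfl

lemma restrictDerivation_bijective (hG : ∀ g ∈ G, ¬ IsPseudoReflection g) [Finite G] :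
    Function.Bijective (restrictDerivation G) := by
  constructor
  · intro d e h
    refine Subtype.ext (sub_eq_zero.1 (derivation_eq_zero_of_invariantRing G hG _ fun b => ?_))
    rw [Derivation.sub_apply, sub_eq_zero, ← restrictDerivation_apply, h,
      restrictDerivation_apply]
  · intro δ
    obtain ⟨p, q, h⟩ := exists_vectorField G hG δ
    let d : Derivation ℂ PlaneRing PlaneRing := mkDerivation ℂ ![p, q]
    have hd : ∀ b : invariantRing G, d b = δ b := fun b => by
      rw [derivation_plane_apply, mkDerivation_X, mkDerivation_X, h]
      rfl
    refine ⟨⟨d, fun g hg a => ?_⟩, ?_⟩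
    -- The lift is automatically invariant: `d` and its conjugate agree on the invariants.
    · have : conjDerivation g d - d = 0 := derivation_eq_zero_of_invariantRing G hG _ fun b => by
        rw [Derivation.sub_apply, sub_eq_zero]
        change polyAct g (d (polyAct g⁻¹ b)) = d b
        rw [b.2 _ (inv_mem hg), hd, (δ b).2 g hg]
      exact DFunLike.congr_fun (sub_eq_zero.1 this) a
    · exact Derivation.ext fun b => Subtype.ext (hd b)

/-- Restriction identifies the invariant derivations with the derivations of the invariant
ring. -/
def derivationEquiv (hG : ∀ g ∈ G, ¬ IsPseudoReflection g) [Finite G] :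
    invariantDerivations G ≃ₗ[invariantRing G] Derivation ℂ (invariantRing G) (invariantRing G) :=
  LinearEquiv.ofBijective (restrictDerivation G) (restrictDerivation_bijective G hG)

lemma derivationEquiv_apply (hG : ∀ g ∈ G, ¬ IsPseudoReflection g) [Finite G]
    (d : invariantDerivations G) (b : invariantRing G) :
    (derivationEquiv G hG d b : PlaneRing) = d.1 b := rfl

lemma derivationEquiv_lie (hG : ∀ g ∈ G, ¬ IsPseudoReflection g) [Finite G]
    (d e : invariantDerivations G) :
    derivationEquiv G hG ⁅d, e⁆ = ⁅derivationEquiv G hG d, derivationEquiv G hG e⁆ := by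
  ext b
  rw [Derivation.commutator_apply]
  rfl

end Restriction

end LRChern

namespace LRChern

/-! ### Traces of covariant derivatives and the Chern cochain -/

section Trace

/-- The trace commutes with covariant differentiation: if `N` is an additive operator on a finite
free module with `N (b m) = b N m + d(b) m`, then `tr [N, φ] = d (tr φ)`. -/
lemma trace_commutator_eq_derivation {F B M : Type*} [CommRing F] [CommRing B] [Algebra F B]
    [AddCommGroup M] [Module B M] [Module.Free B M] [Module.Finite B M] (d : Derivation F B B)
    (N : M →+ M) (hN : ∀ (b : B) (m : M), N (b • m) = b • N m + d b • m)
    (φ ψ : Module.End B M) (hψ : ∀ m, ψ m = N (φ m) - φ (N m)) :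
    LinearMap.trace B M ψ = d (LinearMap.trace B M φ) := by
  classical
  let e := Module.Free.chooseBasis B M
  have tr : ∀ χ : Module.End B M, LinearMap.trace B M χ = ∑ i, e.repr (χ (e i)) i := fun χ => by
    rw [LinearMap.trace_eq_matrix_trace B e, Matrix.trace]
    exact Finset.sum_congr rfl fun i _ => LinearMap.toMatrix_apply _ _ _ _ _
  -- In a basis, `N` is `d` on coordinates plus a connection matrix.
  have hφ : ∀ i, e.repr (φ (N (e i))) i = ∑ j, e.repr (N (e i)) j * e.repr (φ (e j)) i := fun i => by
    conv_lhs => rw [← e.sum_repr (N (e i))]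
    rw [map_sum, map_sum, Finsupp.finsetSum_apply]
    simp only [map_smul, Finsupp.smul_apply, smul_eq_mul]
  have hNφ : ∀ i, e.repr (N (φ (e i))) i =
      ∑ j, e.repr (φ (e i)) j * e.repr (N (e j)) i + d (e.repr (φ (e i)) i) := fun i => by
    conv_lhs => rw [← e.sum_repr (φ (e i))]
    rw [map_sum, map_sum, Finsupp.finsetSum_apply]
    simp only [hN, map_add, map_smul, Finsupp.add_apply, Finsupp.smul_apply, smul_eq_mul,
      Finset.sum_add_distrib, Module.Basis.repr_self]
    congr 1
    rw [Finset.sum_eq_single i (fun j _ hj => by rw [Finsupp.single_eq_of_ne hj.symm, mul_zero])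
      (fun h => (h (Finset.mem_univ i)).elim), Finsupp.single_eq_same, mul_one]
  rw [tr, tr, map_sum]
  simp only [hψ, map_sub, Finsupp.sub_apply, hφ, hNφ, Finset.sum_sub_distrib,
    Finset.sum_add_distrib]
  -- The connection matrix enters the trace through its commutator with the matrix of `φ`, so it
  -- cancels; only `d` of the diagonal entries remains.
  rw [Finset.sum_comm (f := fun i j => e.repr (N (e i)) j * e.repr (φ (e j)) i)]
  simp only [mul_comm (e.repr (N _) _)]
  abel

variable {F A W : Type*} [CommRing F] [CommRing A] [Algebra F A]
  [AddCommGroup W] [Module F W] [Module A W]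

/-- The extension of a covariant derivation of `W` along `d` to `B ⊗ W`, for a derivation `d'` of
the `A`-algebra `B` that extends `d`. -/
def extendCovariant {B : Type*} [CommRing B] [Algebra A B] [Algebra F B] (d : Derivation F A A)
    (d' : Derivation F B B) (hd : ∀ (a : A) (b : B), d' (a • b) = a • d' b + d a • b)
    (p : Module.End F W) (hp : ∀ (a : A) (w : W), p (a • w) = a • p w + d a • w) :
    B ⊗[A] W →+ B ⊗[A] W :=
  TensorProduct.liftAddHom
    (AddMonoidHom.mk' (fun b => AddMonoidHom.mk' (fun w => d' b ⊗ₜ[A] w + b ⊗ₜ[A] p w)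
      fun v w => by
        simp only [map_add, TensorProduct.tmul_add]
        abel)
      fun b c => by
        ext w
        simp only [AddMonoidHom.mk'_apply, AddMonoidHom.add_apply, map_add, TensorProduct.add_tmul]
        abel)
    fun a b w => by
      simp only [AddMonoidHom.mk'_apply, hd, hp, TensorProduct.add_tmul, TensorProduct.tmul_add,
        TensorProduct.smul_tmul]
      abel

lemma extendCovariant_tmul {B : Type*} [CommRing B] [Algebra A B] [Algebra F B]
    (d : Derivation F A A) (d' : Derivation F B B)
    (hd : ∀ (a : A) (b : B), d' (a • b) = a • d' b + d a • b)
    (p : Module.End F W) (hp : ∀ (a : A) (w : W), p (a • w) = a • p w + d a • w) (b : B) (w : W) :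
    extendCovariant d d' hd p hp (b ⊗ₜ w) = d' b ⊗ₜ[A] w + b ⊗ₜ[A] p w := rfl

lemma extendCovariant_smul {B : Type*} [CommRing B] [Algebra A B] [Algebra F B]
    (d : Derivation F A A) (d' : Derivation F B B)
    (hd : ∀ (a : A) (b : B), d' (a • b) = a • d' b + d a • b)
    (p : Module.End F W) (hp : ∀ (a : A) (w : W), p (a • w) = a • p w + d a • w)
    (b : B) (m : B ⊗[A] W) :
    extendCovariant d d' hd p hp (b • m) = b • extendCovariant d d' hd p hp m + d' b • m := by
  induction m with
  | zero => simp
  | add x y hx hy =>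
    simp only [smul_add, map_add, hx, hy]
    abel
  | tmul c w =>
    simp only [TensorProduct.smul_tmul', extendCovariant_tmul, smul_eq_mul, Derivation.leibniz,
      TensorProduct.add_tmul, smul_add, mul_comm c]
    abel

variable [IsScalarTower F A W]

/-- The covariant derivative `[∇_x, φ]` of an endomorphism. -/
def Connection.endDerivative {L : Type*} [LieRing L] [Module A L] [LieRingModule L A]
    (D : Connection F A L W) (x : L) (φ : Module.End A W) : Module.End A W where
  toFun w := D.toLin x (φ w) - φ (D.toLin x w)
  map_add' v w := by simp only [map_add]; abel
  map_smul' a w := by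
    simp only [map_smul, D.leibniz, map_add, smul_sub, RingHom.id_apply]
    abel

/-- The difference of two connections. -/
def Connection.difference {L : Type*} [LieRing L] [Module A L] [LieRingModule L A]
    (D E : Connection F A L W) : L →ₗ[A] Module.End A W where
  toFun x :=
    { toFun := fun w => E.toLin x w - D.toLin x w
      map_add' := fun v w => by simp only [map_add]; abel
      map_smul' := fun a w => by
        simp only [D.leibniz, E.leibniz, smul_sub, RingHom.id_apply]
        abel }
  map_add' x y := by
    ext w
    simp only [map_add, LinearMap.add_apply, LinearMap.coe_mk, AddHom.coe_mk]
    abel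
  map_smul' a x := by
    ext w
    simp only [map_smul, LinearMap.smul_apply, LinearMap.coe_mk, AddHom.coe_mk, smul_sub,
      RingHom.id_apply]

/-- The curvature of `E = D + φ` for a flat connection `D`. -/
lemma Connection.IsFlat.curvature_eq {L : Type*} [LieRing L] [Module A L] [LieRingModule L A]
    {D : Connection F A L W} (hD : D.IsFlat) (E : Connection F A L W) (x y : L) :
    E.curvature x y = D.endDerivative x (D.difference E y) - D.endDerivative y (D.difference E x)
      - D.difference E ⁅x, y⁆ + (D.difference E x * D.difference E y
        - D.difference E y * D.difference E x) := by
  ext w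
  have h := hD x y w
  simp only [curvature_apply, endDerivative, difference, LinearMap.add_apply, LinearMap.sub_apply,
    Module.End.mul_apply, LinearMap.coe_mk, AddHom.coe_mk, map_sub, h]
  abel

/-- `W_p` is the base change of the finite free module `W_f` along `A_f → A_p`. -/
lemma free_atPrime_of_mem_locallyFreeOpen (p : locallyFreeOpen A W) :
    Module.Free (Localization.AtPrime p.1.asIdeal) (Localization.AtPrime p.1.asIdeal ⊗[A] W) ∧
      Module.Finite (Localization.AtPrime p.1.asIdeal)
        (Localization.AtPrime p.1.asIdeal ⊗[A] W) := by
  obtain ⟨p, f, hf, h₁, h₂⟩ := p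
  let i : Localization.Away f →+* Localization.AtPrime p.asIdeal :=
    IsLocalization.Away.lift f (g := algebraMap A (Localization.AtPrime p.asIdeal))
      (IsLocalization.map_units (Localization.AtPrime p.asIdeal) (⟨f, hf⟩ : p.asIdeal.primeCompl))
  let _ : Algebra (Localization.Away f) (Localization.AtPrime p.asIdeal) := i.toAlgebra
  have : IsScalarTower A (Localization.Away f) (Localization.AtPrime p.asIdeal) :=
    IsScalarTower.of_algebraMap_eq fun a => (IsLocalization.Away.lift_eq f _ a).symm
  let e := TensorProduct.AlgebraTensorModule.cancelBaseChange A (Localization.Away f)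
    (Localization.AtPrime p.asIdeal) (Localization.AtPrime p.asIdeal) W
  exact ⟨Module.Free.of_equiv e, Module.Finite.equiv e⟩

/-- The check is made on stalks. `∇_x` extends to `W_p` by the product rule, and its commutator with
the base change of `φ` is the base change of `[∇_x, φ]`, since the terms with the derivative of the
scalar cancel. -/
lemma traceSection_endDerivative (D : Connection F A (linearLieRinehart F A W) W)
    (x : linearLieRinehart F A W) (φ : Module.End A W) :
    traceSection A W (D.endDerivative x φ) =
      (structureConnection F A W).toLin x (traceSection A W φ) := by
  ext p
  obtain ⟨_, _⟩ := free_atPrime_of_mem_locallyFreeOpen p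
  refine trace_commutator_eq_derivation
    (extendDerivation p.1.asIdeal.primeCompl (Localization.AtPrime p.1.asIdeal) x.1)
    (extendCovariant x.1 _ (extendDerivation_smul_apply _ _ x.1) (D.toLin x) (D.leibniz x))
    (extendCovariant_smul _ _ _ _ _) _ _ fun m => ?_
  induction m with
  | zero => simp
  | add v w hv hw =>
    simp only [map_add, hv, hw]
    abel
  | tmul b w =>
    simp only [LinearMap.baseChange_tmul, extendCovariant_tmul, map_add, Connection.endDerivative,
      LinearMap.coe_mk, AddHom.coe_mk, TensorProduct.tmul_sub]
    abel

lemma traceSection_commutator (φ ψ : Module.End A W) :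
    traceSection A W (φ * ψ - ψ * φ) = 0 := by
  rw [map_sub, sub_eq_zero]
  ext p
  refine (congrArg _ (LinearMap.baseChange_mul φ ψ)).trans
    ((LinearMap.trace_mul_comm _ _ _).trans (congrArg _ (LinearMap.baseChange_mul ψ φ).symm))

lemma extendDerivation_lie (S : Submonoid A) (B : Type*) [CommRing B] [Algebra A B]
    [IsLocalization S B] [Algebra F B] [IsScalarTower F A B] (d e : Derivation F A A) :
    extendDerivation S B ⁅d, e⁆ = ⁅extendDerivation S B d, extendDerivation S B e⁆ :=
  derivation_localization_ext S B _ _ fun a => by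
    simp only [extendDerivation_algebraMap, Derivation.commutator_apply, map_sub]

lemma structureConnection_isFlat : (structureConnection F A W).IsFlat := fun x y s => by
  ext p
  exact (DFunLike.congr_fun (extendDerivation_lie _ _ x.1 y.1) (s.1 p)).trans
    (Derivation.commutator_apply _)

/-- `d² ∘ d¹ = 0` in the Chevalley-Hochschild complex of a flat connection. -/
lemma mem_twoCocycles_of_mem_twoCoboundaries {L M : Type*} [LieRing L] [Module A L]
    [LieRingModule L A] [AddCommGroup M] [Module F M] [Module A M] [IsScalarTower F A M]
    {D : Connection F A L M} (hD : D.IsFlat) {c : TwoCochains F A L M}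
    (hc : c ∈ twoCoboundaries D) : c ∈ twoCocycles D := by
  obtain ⟨b, h⟩ := hc
  intro x y z
  -- By flatness the second-order terms cancel; what survives is `b` applied to the Jacobi identity.
  have hJ : b ⁅⁅x, y⁆, z⁆ - b ⁅⁅x, z⁆, y⁆ + b ⁅⁅y, z⁆, x⁆ = 0 := by
    rw [← map_sub, ← map_add, ← map_zero b]
    congr 1
    rw [lie_lie, ← lie_skew ⁅x, z⁆ y, ← lie_skew ⁅y, z⁆ x]
    abel
  simp only [h, map_sub, hD _ _ _]
  rw [← hJ]
  abel

/-- A flat connection trivializes the Chern cochain of any other connection. -/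
lemma chernCochain_mem_twoCoboundaries {D : Connection F A (linearLieRinehart F A W) W}
    (hD : D.IsFlat) (E : Connection F A (linearLieRinehart F A W) W) :
    chernCochain E ∈ twoCoboundaries (structureConnection F A W) := by
  -- The primitive is the trace of `E - D`.
  refine ⟨(traceSection A W).comp (D.difference E), fun x y => ?_⟩
  change traceSection A W (E.curvature x y) = _
  rw [hD.curvature_eq, map_add, traceSection_commutator, add_zero, map_sub, map_sub,
    traceSection_endDerivative, traceSection_endDerivative]
  rfl

lemma chernCochain_mem_twoCocycles {D : Connection F A (linearLieRinehart F A W) W}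
    (hD : D.IsFlat) (E : Connection F A (linearLieRinehart F A W) W) :
    chernCochain E ∈ twoCocycles (structureConnection F A W) :=
  mem_twoCocycles_of_mem_twoCoboundaries (structureConnection_isFlat (F := F) (A := A) (W := W))
    (chernCochain_mem_twoCoboundaries hD E)

lemma firstChernClass_eq_zero (E : Connection F A (linearLieRinehart F A W) W)
    (hZ : chernCochain E ∈ twoCocycles (structureConnection F A W))
    (hB : chernCochain E ∈ twoCoboundaries (structureConnection F A W)) :
    firstChernClass E hZ = 0 :=
  (Submodule.Quotient.mk_eq_zero _).2 (Submodule.mem_comap.2 hB)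

/-- A module with a flat connection has vanishing first Chern class. -/
theorem firstChernClassVanishes_of_isFlat (D : Connection F A (linearLieRinehart F A W) W)
    (hD : D.IsFlat) : FirstChernClassVanishes F A W :=
  ⟨⟨D⟩, fun E => ⟨chernCochain_mem_twoCocycles hD E,
    firstChernClass_eq_zero E _ (chernCochain_mem_twoCoboundaries hD E)⟩⟩

/-- A connection along all derivations restricts to the linear Lie-Rinehart algebra. -/
def Connection.toLinearLieRinehart (D : Connection F A (Derivation F A A) W) :
    Connection F A (linearLieRinehart F A W) W where
  toLin := D.toLin.comp (linearLieRinehart F A W).toSubmodule.subtype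
  leibniz x := D.leibniz x.1

end Trace

end LRChern

/-! ### The flat connection on the module of invariants -/

namespace LRChern

/-- A connection from its values. -/
def Connection.ofFun {F A L W : Type*} [CommRing F] [CommRing A] [Algebra F A]
    [LieRing L] [Module A L] [LieRingModule L A] [AddCommGroup W] [Module F W] [Module A W]
    [IsScalarTower F A W] (f : L → Module.End F W)
    (hadd : ∀ x y w, f (x + y) w = f x w + f y w) (hsmul : ∀ (a : A) x w, f (a • x) w = a • f x w)
    (hleibniz : ∀ (x : L) (a : A) (w : W), f x (a • w) = a • f x w + ⁅x, a⁆ • w) :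
    Connection F A L W where
  toLin :=
    { toFun := f
      map_add' := fun x y => LinearMap.ext (hadd x y)
      map_smul' := fun a x => LinearMap.ext (hsmul a x) }
  leibniz := hleibniz

section InvariantModule

variable (G : Subgroup (Matrix.GeneralLinearGroup (Fin 2) ℂ))
  {V : Type*} [AddCommGroup V] [Module ℂ V]

lemma trivialConnection_isFlat (F A V : Type*) [CommRing F] [CommRing A] [Algebra F A]
    [AddCommGroup V] [Module F V] : (trivialConnection F A V).IsFlat := fun d e w => by
  induction w with
  | zero => simp
  | add v w hv hw =>
    simp only [map_add, hv, hw]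
    abel
  | tmul a v =>
    change ⁅d, e⁆ a ⊗ₜ[F] v = d (e a) ⊗ₜ[F] v - e (d a) ⊗ₜ[F] v
    rw [Derivation.commutator_apply, TensorProduct.sub_tmul]

/-- An invariant `d` commutes with `G` on the factor `A`, and `d ⊗ 1` leaves `V` alone, so it
commutes with the diagonal action. -/
lemma trivialConnection_mem (ρ : Representation ℂ G V) {d : Derivation ℂ PlaneRing PlaneRing}
    (hd : d ∈ invariantDerivations G) {w : PlaneRing ⊗[ℂ] V} (hw : w ∈ invariantModule G ρ) :
    (trivialConnection ℂ PlaneRing V).toLin d w ∈ invariantModule G ρ := by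
  intro g
  have key : ∀ w : PlaneRing ⊗[ℂ] V,
      TensorProduct.map (polyAct g.1).toLinearMap (ρ g)
          ((trivialConnection ℂ PlaneRing V).toLin d w) =
        (trivialConnection ℂ PlaneRing V).toLin d
          (TensorProduct.map (polyAct g.1).toLinearMap (ρ g) w) := by
    intro w
    induction w with
    | zero => simp
    | add v w hv hw => simp only [map_add, hv, hw]
    | tmul a v =>
      change polyAct g.1 (d a) ⊗ₜ[ℂ] ρ g v = d (polyAct g.1 a) ⊗ₜ[ℂ] ρ g v
      rw [polyAct_derivation G hd g.2]
  rw [key, hw g]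

/-- The operator on the module of invariants defined by an invariant derivation. -/
def invariantOperator (ρ : Representation ℂ G V) (d : invariantDerivations G) :
    Module.End ℂ (invariantModule G ρ) where
  toFun w := ⟨(trivialConnection ℂ PlaneRing V).toLin d.1 w.1, trivialConnection_mem G ρ d.2 w.2⟩
  map_add' _ _ := Subtype.ext (map_add _ _ _)
  map_smul' _ _ := Subtype.ext (map_smul _ _ _)

lemma invariantOperator_apply (ρ : Representation ℂ G V) (d : invariantDerivations G)
    (w : invariantModule G ρ) : (invariantOperator G ρ d w : PlaneRing ⊗[ℂ] V) =
      (trivialConnection ℂ PlaneRing V).toLin d.1 w := rfl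

lemma invariantOperator_add (ρ : Representation ℂ G V) (d e : invariantDerivations G)
    (w : invariantModule G ρ) : invariantOperator G ρ (d + e) w =
      invariantOperator G ρ d w + invariantOperator G ρ e w :=
  Subtype.ext (LinearMap.congr_fun
    ((trivialConnection ℂ PlaneRing V).toLin.map_add d.1 e.1) w.1)

/-- The hypothesis compares the underlying vector fields, so that `A`-linearity of the trivial
connection applies directly. -/
lemma invariantOperator_smul (ρ : Representation ℂ G V) (b : invariantRing G)
    (d e : invariantDerivations G) (h : e.1 = (b : PlaneRing) • d.1) (w : invariantModule G ρ) :
    invariantOperator G ρ e w = b • invariantOperator G ρ d w := by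
  refine Subtype.ext ?_
  rw [invariantOperator_apply, h]
  exact LinearMap.congr_fun ((trivialConnection ℂ PlaneRing V).toLin.map_smul (b : PlaneRing) d.1)
    w.1

/-- The connection on the module of invariants induced by the trivial connection. -/
def invariantConnection (hG : ∀ g ∈ G, ¬ IsPseudoReflection g) [Finite G]
    (ρ : Representation ℂ G V) :
    Connection ℂ (invariantRing G) (Derivation ℂ (invariantRing G) (invariantRing G))
      (invariantModule G ρ) :=
  Connection.ofFun (fun δ => invariantOperator G ρ ((derivationEquiv G hG).symm δ))
    (fun δ ε w => by rw [map_add, invariantOperator_add])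
    (fun b δ w => invariantOperator_smul G ρ b _ _
      (congrArg Subtype.val ((derivationEquiv G hG).symm.map_smul b δ)) w)
    fun δ b w => by
      obtain ⟨d, rfl⟩ := (derivationEquiv G hG).surjective δ
      rw [LinearEquiv.symm_apply_apply]
      exact Subtype.ext ((trivialConnection ℂ PlaneRing V).leibniz d.1 (b : PlaneRing) w.1)

lemma invariantConnection_apply (hG : ∀ g ∈ G, ¬ IsPseudoReflection g) [Finite G]
    (ρ : Representation ℂ G V) (δ : invariantDerivations G) (w : invariantModule G ρ) :
    ((invariantConnection G hG ρ).toLin (derivationEquiv G hG δ) w : PlaneRing ⊗[ℂ] V) =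
      (trivialConnection ℂ PlaneRing V).toLin δ.1 w := by
  rw [← invariantOperator_apply]
  conv_rhs => rw [← (derivationEquiv G hG).symm_apply_apply δ]
  rfl

lemma invariantConnection_isFlat (hG : ∀ g ∈ G, ¬ IsPseudoReflection g) [Finite G]
    (ρ : Representation ℂ G V) : (invariantConnection G hG ρ).IsFlat := by
  intro δ ε w
  obtain ⟨d, rfl⟩ := (derivationEquiv G hG).surjective δ
  obtain ⟨e, rfl⟩ := (derivationEquiv G hG).surjective ε
  refine Subtype.ext ?_
  rw [← derivationEquiv_lie, invariantConnection_apply]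
  change _ = ((invariantConnection G hG ρ).toLin (derivationEquiv G hG d)
      ((invariantConnection G hG ρ).toLin (derivationEquiv G hG e) w) : PlaneRing ⊗[ℂ] V) -
    ((invariantConnection G hG ρ).toLin (derivationEquiv G hG e)
      ((invariantConnection G hG ρ).toLin (derivationEquiv G hG d) w) : PlaneRing ⊗[ℂ] V)
  simp only [invariantConnection_apply]
  exact trivialConnection_isFlat ℂ PlaneRing V d.1 e.1 w.1

end InvariantModule

end LRChern

open LRChern
theorem theorem4p2 (G : Subgroup (Matrix.GeneralLinearGroup (Fin 2) ℂ)) [Finite G]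
    (hG : ∀ g ∈ G, ¬ IsPseudoReflection g)
    {V : Type*} [AddCommGroup V] [Module ℂ V] [FiniteDimensional ℂ V]
    (ρ : Representation ℂ G V) :
    -- the invariant derivations act on `W_ρ` through the trivial connection
    (∀ δ ∈ invariantDerivations G, ∀ w ∈ invariantModule G ρ,
      (trivialConnection ℂ PlaneRing V).toLin δ w ∈ invariantModule G ρ) ∧
    -- restriction to `A^G` identifies `Der(A)^G` with `Der(A^G)`
    ∃ e : invariantDerivations G ≃ₗ[invariantRing G]
        Derivation ℂ (invariantRing G) (invariantRing G),
      (∀ δ b, (e δ b : PlaneRing) = δ.1 b) ∧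
      (∀ δ ε, e ⁅δ, ε⁆ = ⁅e δ, e ε⁆) ∧
      -- the trivial connection induces a flat `Der(A^G)`-connection on `W_ρ`
      (∃ D : Connection ℂ (invariantRing G)
          (Derivation ℂ (invariantRing G) (invariantRing G)) (invariantModule G ρ),
        D.IsFlat ∧ ∀ δ w, (D.toLin (e δ) w : PlaneRing ⊗[ℂ] V) =
          (trivialConnection ℂ PlaneRing V).toLin δ.1 w) ∧
      -- so `V_W` is all of `Der(A^G)`
      (∀ δ, δ ∈ linearLieRinehart ℂ (invariantRing G) (invariantModule G ρ)) ∧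
      -- `c₁(W_ρ) = 0`
      FirstChernClassVanishes ℂ (invariantRing G) (invariantModule G ρ) := by
  refine ⟨fun δ hδ w hw => trivialConnection_mem G ρ hδ hw, derivationEquiv G hG,
    derivationEquiv_apply G hG, derivationEquiv_lie G hG,
    ⟨invariantConnection G hG ρ, invariantConnection_isFlat G hG ρ,
      invariantConnection_apply G hG ρ⟩, fun δ => ?_, ?_⟩
  -- A covariant derivative along `δ` is a Hochschild primitive of the Kodaira–Spencer cocycle of
  -- `δ`.
  · exact (mem_ker_kodairaSpencer _ _ _ δ).2
      ⟨(invariantConnection G hG ρ).toLin δ, (invariantConnection G hG ρ).leibniz δ⟩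
  · exact firstChernClassVanishes_of_isFlat (invariantConnection G hG ρ).toLinearLieRinehart
      fun x y => invariantConnection_isFlat G hG ρ x.1 y.1
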